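/- Let $d\ge 3$ and let $M$ be a compact smooth $d$-manifold with boundary $\Sigma=\partial M$, equipped with a conformal class $[g]$ of smooth (up to the boundary) Riemannian metrics. For $g\in[g]$ let $\nabla$ be the Levi-Civita connection, $\mathrm{Ric}=(d-2)P+J\,g$ with $J=g^{ab}P_{ab}$ (so $P$ is the Schouten tensor), and $\Delta=-\nabla^a\nabla_a$. A (smooth) standard tractor $I$ is given in each scale $g\in[g]$ by a triple $I\overset{g}{=}(\sigma,\mu_a,\rho)$ of a function, a $1$-form and a function (trivialised sections of $\mathcal E[1]$, $\mathcal E_a[1]$, $\mathcal E[-1]$); the triple in the scale $\hat g=e^{2\omega}g$ is, with $\Upsilon=d\omega$, $$\hat\sigma=e^{\omega}\sigma,\qquad \hat\mu_a=e^{\omega}(\mu_a+\sigma\Upsilon_a),\qquad \hat\rho=e^{-\omega}\bigl(\rho-\Upsilon^a\mu_a-\tfrac12|\Upsilon|^2\sigma\bigr).$$ It is parallel if $\nabla_a\sigma-\mu_a=0$, $\nabla_a\mu_b+g_{ab}\rho+P_{ab}\sigma=0$ and $\nabla_a\rho-P_{ac}\mu^c=0$. Let $(M,[g],I)$ be a Poincaré–Einstein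 manifold: $I$ is a parallel standard tractor whose density $\sigma$ is a non-negative defining density for the boundary (that is, $\sigma>0$ on $M\setminus\Sigma$, and $\sigma=0$ and $d\sigma\neq0$ at every point of $\Sigma$), and the metric $g_+=\sigma^{-2}g$ on $M\setminus\Sigma$ (which does not depend on the scale $g$) satisfies $\mathrm{Ric}(g_+)=-(d-1)\,g_+$. Then along $\Sigma$ the tractor $I$ equals the normal tractor $N$ of $\Sigma$. Explicitly, for every scale $g\in[g]$ the inward unit conormal of $\Sigma$ with respect to $g$ extends to a smooth $1$-form $n_a$ on $M$, and for every such extension $n_a$, with mean curvature $$H=\frac1{d-1}\bigl(\nabla_a n^a-n^an^b\nabla_a n_b\bigr)\quad\text{along }\Sigma,$$ one has, at every point of $\Sigma$, $$I\overset{g}{=}(0,\,n_a,\,-H)=:N\qquad\text{and}\qquad H=-\frac1d\,\Delta\sigma .$$ -/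

import Mathlib

open scoped Manifold ContDiff Bundle
open Set

noncomputable section

/-! Throughout, `M` is a smooth `d`-manifold with boundary, modelled on the closed half-space
`{y | 0 ≤ y 0}` of `ℝ^d`. The Laplacian has the sign `Δ = -∇^a ∇_a`. -/

namespace ConfGeom

section Charts

variable {d : ℕ} [NeZero d] {M : Type*} [TopologicalSpace M]
  [ChartedSpace (EuclideanHalfSpace d) M] [IsManifold (𝓡∂ d) ∞ M]

/-- Covectors at `x`. -/
abbrev Covector (d : ℕ) [NeZero d] {M : Type*} [TopologicalSpace M]
    [ChartedSpace (EuclideanHalfSpace d) M] (x : M) : Type :=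
  TangentSpace (𝓡∂ d) x →L[ℝ] ℝ

/-- Fields of covectors on `M`, with no regularity. -/
abbrev CovectorField (d : ℕ) [NeZero d] (M : Type*) [TopologicalSpace M]
    [ChartedSpace (EuclideanHalfSpace d) M] : Type _ :=
  ∀ x : M, Covector d x

/-- Fields of bilinear forms on the tangent spaces of `M`, with no regularity. -/
abbrev BilinField (d : ℕ) [NeZero d] (M : Type*) [TopologicalSpace M]
    [ChartedSpace (EuclideanHalfSpace d) M] : Type _ :=
  ∀ x : M, TangentSpace (𝓡∂ d) x →L[ℝ] TangentSpace (𝓡∂ d) x →L[ℝ] ℝ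

/-- Smoothness (up to the boundary) of a covector field, as a section of the cotangent bundle. -/
def CovectorField.Smooth (μ : CovectorField d M) : Prop :=
  ContMDiff (𝓡∂ d) ((𝓡∂ d).prod 𝓘(ℝ, EuclideanSpace ℝ (Fin d) →L[ℝ] ℝ)) ∞
    (fun x => Bundle.TotalSpace.mk' (EuclideanSpace ℝ (Fin d) →L[ℝ] ℝ)
      (E := fun x : M => TangentSpace (𝓡∂ d) x →L[ℝ] ℝ) x (μ x))

/-- The differential of a function, as a covector field. -/
def differential (f : M → ℝ) : CovectorField d M :=
  fun x => (mfderiv (𝓡∂ d) 𝓘(ℝ, ℝ) f x : TangentSpace (𝓡∂ d) x →L[ℝ] ℝ)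

/-- The coordinate vector field `∂_i` of the preferred chart at `p`, at the point `q`. -/
def coordVec (p : M) (i : Fin d) (q : M) : TangentSpace (𝓡∂ d) q :=
  (trivializationAt (EuclideanSpace ℝ (Fin d)) (TangentSpace (𝓡∂ d) : M → Type _) p).symmL ℝ q
    (EuclideanSpace.single i 1)

/-- The point of `M` with coordinates `y` in the preferred chart at `p`. -/
def pt (p : M) (y : EuclideanSpace ℝ (Fin d)) : M := (extChartAt (𝓡∂ d) p).symm y

/-- The coordinates of `p` in its own preferred chart. -/
def base (p : M) : EuclideanSpace ℝ (Fin d) := extChartAt (𝓡∂ d) p p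

/-- The partial derivative `∂_i f`, taken within the half-space (one-sided in the normal
direction at boundary points). -/
def pderiv (i : Fin d) (f : EuclideanSpace ℝ (Fin d) → ℝ) (y : EuclideanSpace ℝ (Fin d)) : ℝ :=
  fderivWithin ℝ f (range (𝓡∂ d)) y (EuclideanSpace.single i 1)

/-- The components `μ_i = μ(∂_i)` in the chart at `p`, as functions of the coordinates. -/
def covComp (μ : CovectorField d M) (p : M) (i : Fin d) (y : EuclideanSpace ℝ (Fin d)) : ℝ :=
  μ (pt p y) (coordVec p i (pt p y))

/-- The matrix `G_{ij} = G(∂_i, ∂_j)` in the chart at `p`, as a function of the coordinates. -/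
def gram (G : BilinField d M) (p : M) (y : EuclideanSpace ℝ (Fin d)) :
    Matrix (Fin d) (Fin d) ℝ :=
  Matrix.of fun i j => G (pt p y) (coordVec p i (pt p y)) (coordVec p j (pt p y))

/-- The inverse matrix `G^{ij}` in the chart at `p`. -/
def gramInv (G : BilinField d M) (p : M) (y : EuclideanSpace ℝ (Fin d)) :
    Matrix (Fin d) (Fin d) ℝ :=
  (gram G p y)⁻¹

/-- Christoffel symbols `Γ^k_{ij}` of the Levi-Civita connection of `G` in the chart at `p`. -/
def christoffel (G : BilinField d M) (p : M) (k i j : Fin d)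
    (y : EuclideanSpace ℝ (Fin d)) : ℝ :=
  (1 / 2) * ∑ l, gramInv G p y k l *
    (pderiv i (fun z => gram G p z j l) y + pderiv j (fun z => gram G p z i l) y
      - pderiv l (fun z => gram G p z i j) y)

/-- The component `∇_a μ_b` at `p` of the Levi-Civita derivative of a covector field, in the
chart at `p`. -/
def covDeriv (G : BilinField d M) (μ : CovectorField d M) (p : M) (a b : Fin d) : ℝ :=
  pderiv a (covComp μ p b) (base p)
    - ∑ c, christoffel G p c a b (base p) * covComp μ p c (base p)

/-- The component `Ric_{ab} = R_{ca}{}^c{}_b` at `p` of the Ricci tensor, in the chart at `p`;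
here `(∇_a ∇_b - ∇_b ∇_a) V^c = R_{ab}{}^c{}_d V^d`. -/
def ricci (G : BilinField d M) (p : M) (a b : Fin d) : ℝ :=
  ∑ c, (pderiv c (christoffel G p c a b) (base p) - pderiv a (christoffel G p c c b) (base p)
    + ∑ e, (christoffel G p c c e (base p) * christoffel G p e a b (base p)
      - christoffel G p c a e (base p) * christoffel G p e c b (base p)))

/-- The trace `J` of the Schouten tensor, `J = Scal / (2 (d - 1))`. -/
def schoutenTrace (G : BilinField d M) (p : M) : ℝ :=
  (∑ a, ∑ b, gramInv G p (base p) a b * ricci G p a b) / (2 * ((d : ℝ) - 1))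

/-- The component `P_{ab}` at `p` of the Schouten tensor, defined by `Ric = (d - 2) P + J G`. -/
def schouten (G : BilinField d M) (p : M) (a b : Fin d) : ℝ :=
  (ricci G p a b - schoutenTrace G p * gram G p (base p) a b) / ((d : ℝ) - 2)

/-- The inner product `G^{ab} μ_a ν_b` of two covectors at `p`. -/
def covInner (G : BilinField d M) (p : M) (μ ν : Covector d p) : ℝ :=
  ∑ a, ∑ b, gramInv G p (base p) a b * μ (coordVec p a p) * ν (coordVec p b p)

/-- The Laplacian `Δ f = -G^{ab} ∇_a ∇_b f`. -/
def laplacian (G : BilinField d M) (f : M → ℝ) (p : M) : ℝ :=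
  -∑ a, ∑ b, gramInv G p (base p) a b * covDeriv G (differential f) p a b

/-- `n` is a smooth covector field which at every boundary point is the inward unit conormal of
the boundary: it annihilates the vectors tangent to the boundary, is positive on inward pointing
vectors and has length one. (The tangent space at `x` is identified with `ℝ^d` by the preferred
chart at `x`, in which `M` is `{y | 0 ≤ y 0}` and the boundary is `{y | y 0 = 0}`.) -/
structure IsUnitConormal (G : BilinField d M) (n : CovectorField d M) : Prop where
  smooth : CovectorField.Smooth n
  tangent : ∀ x ∈ (𝓡∂ d).boundary M, ∀ v : EuclideanSpace ℝ (Fin d), v 0 = 0 →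
    n x (v : TangentSpace (𝓡∂ d) x) = 0
  inward : ∀ x ∈ (𝓡∂ d).boundary M, ∀ v : EuclideanSpace ℝ (Fin d), 0 < v 0 →
    0 < n x (v : TangentSpace (𝓡∂ d) x)
  unit : ∀ x ∈ (𝓡∂ d).boundary M, covInner G x (n x) (n x) = 1

/-- The mean curvature `H = (∇_a n^a - n^a n^b ∇_a n_b) / (d - 1)` at a boundary point `p`,
where `n` is a covector field extending the unit conormal off the boundary. -/
def meanCurvature (G : BilinField d M) (n : CovectorField d M) (p : M) : ℝ :=
  let N : Fin d → ℝ := fun a => ∑ c, gramInv G p (base p) a c * covComp n p c (base p)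
  (∑ a, ∑ b, (gramInv G p (base p) a b - N a * N b) * covDeriv G n p a b) / ((d : ℝ) - 1)

end Charts

section Conformal

variable (d : ℕ) [NeZero d] (M : Type*) [TopologicalSpace M]
  [ChartedSpace (EuclideanHalfSpace d) M] [IsManifold (𝓡∂ d) ∞ M]

/-- Smooth Riemannian metrics on `M` (smooth up to the boundary). -/
abbrev SmoothMetric : Type _ :=
  Bundle.ContMDiffRiemannianMetric (𝓡∂ d) ∞ (EuclideanSpace ℝ (Fin d))
    (TangentSpace (𝓡∂ d) : M → Type _)

variable {d M}

/-- `g' = e^{2u} g` with `u` smooth. -/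
def IsRescaling (g g' : SmoothMetric d M) (u : M → ℝ) : Prop :=
  ContMDiff (𝓡∂ d) 𝓘(ℝ, ℝ) ∞ u ∧
    ∀ (x : M) (v w : TangentSpace (𝓡∂ d) x),
      g'.inner x v w = Real.exp (2 * u x) * g.inner x v w

variable (d M)

/-- Conformal equivalence of metrics. -/
def conformalSetoid : Setoid (SmoothMetric d M) where
  r g g' := ∃ u : M → ℝ, IsRescaling g g' u
  iseqv := by
    refine ⟨fun g => ⟨fun _ => 0, contMDiff_const, ?_⟩, ?_, ?_⟩
    · intro x v w
      simp
    · rintro g g' ⟨u, hu, h⟩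
      refine ⟨fun x => -u x, hu.neg, fun x v w => ?_⟩
      rw [h, ← mul_assoc, ← Real.exp_add]
      simp
    · rintro g g' g'' ⟨u, hu, h⟩ ⟨u', hv, h'⟩
      refine ⟨fun x => u' x + u x, hv.add hu, fun x v w => ?_⟩
      rw [h', h, ← mul_assoc, ← Real.exp_add, mul_add]

/-- Conformal structures on `M`: conformal classes of smooth Riemannian metrics. -/
def ConformalStructure : Type _ := Quotient (conformalSetoid d M)

variable {d M}

/-- The metrics ("scales") in the conformal class `c`. -/
def ConformalStructure.Metric (c : ConformalStructure d M) : Type _ :=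
  {g : SmoothMetric d M // Quotient.mk (conformalSetoid d M) g = c}

/-- The underlying field of inner products of a metric in the conformal class. -/
def ConformalStructure.Metric.form {c : ConformalStructure d M} (g : c.Metric) : BilinField d M :=
  fun x => g.1.inner x

/-- A smooth section of the standard tractor bundle of the conformal structure `c`: in every scale
`g` a triple `(σ, μ_a, ρ)` of trivialised sections of `𝓔[1] ⊕ 𝓔_a[1] ⊕ 𝓔[-1]`, such that the
triples in the scales `g` and `g' = e^{2u} g` are related, with `Υ = du`, by
`σ' = e^u σ`, `μ' = e^u (μ + σ Υ)`, `ρ' = e^{-u} (ρ - g⁻¹(Υ, μ) - ½ |Υ|² σ)`.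
The slot `σ`, a density of weight one, is the canonical projection `h(X, I)` of the tractor. -/
structure Tractor (c : ConformalStructure d M) where
  σ : c.Metric → M → ℝ
  μ : c.Metric → CovectorField d M
  ρ : c.Metric → M → ℝ
  smooth_σ : ∀ g, ContMDiff (𝓡∂ d) 𝓘(ℝ, ℝ) ∞ (σ g)
  smooth_μ : ∀ g, CovectorField.Smooth (μ g)
  smooth_ρ : ∀ g, ContMDiff (𝓡∂ d) 𝓘(ℝ, ℝ) ∞ (ρ g)
  rescale_σ : ∀ (g g' : c.Metric) (u : M → ℝ), IsRescaling g.1 g'.1 u → ∀ x,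
    σ g' x = Real.exp (u x) * σ g x
  rescale_μ : ∀ (g g' : c.Metric) (u : M → ℝ), IsRescaling g.1 g'.1 u → ∀ x,
    μ g' x = Real.exp (u x) • (μ g x + σ g x • differential u x)
  rescale_ρ : ∀ (g g' : c.Metric) (u : M → ℝ), IsRescaling g.1 g'.1 u → ∀ x,
    ρ g' x = Real.exp (-u x) * (ρ g x - covInner g.form x (differential u x) (μ g x)
      - (1 / 2) * covInner g.form x (differential u x) (differential u x) * σ g x)

/-- The value at `x` of a tractor, as a triple in the scale `g`. -/
def Tractor.inScale {c : ConformalStructure d M} (I : Tractor c) (g : c.Metric) (x : M) :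
    ℝ × Covector d x × ℝ :=
  (I.σ g x, I.μ g x, I.ρ g x)

/-- `I` is parallel for the tractor connection
`∇_a (σ, μ_b, ρ) = (∇_a σ - μ_a, ∇_a μ_b + g_{ab} ρ + P_{ab} σ, ∇_a ρ - P_{ac} μ^c)`. -/
def Tractor.IsParallel {c : ConformalStructure d M} (I : Tractor c) : Prop :=
  ∀ (g : c.Metric) (x : M),
    (∀ a, differential (I.σ g) x (coordVec x a x) - I.μ g x (coordVec x a x) = 0) ∧
    (∀ a b, covDeriv g.form (I.μ g) x a b + gram g.form x (base x) a b * I.ρ g x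
      + schouten g.form x a b * I.σ g x = 0) ∧
    (∀ a, differential (I.ρ g) x (coordVec x a x)
      - ∑ b, ∑ e, schouten g.form x a b * gramInv g.form x (base x) b e *
          I.μ g x (coordVec x e x) = 0)

/-- The metric `g₊ = σ⁻² 𝐠` determined by the density `σ` of the tractor `I`, computed in the
scale `g`. It is meaningful where `σ ≠ 0`, and does not depend on `g`. -/
def Tractor.plusMetric {c : ConformalStructure d M} (I : Tractor c) (g : c.Metric) :
    BilinField d M :=
  fun x => ((I.σ g x) ^ 2)⁻¹ • g.form x

/-- `(M, c, I)` is a Poincaré–Einstein manifold: `I` is a parallel standard tractor whose density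
`σ` is a non-negative defining density for the boundary, and on the interior the metric
`g₊ = σ⁻² 𝐠` is Einstein with `Ric(g₊) = -(d - 1) g₊`. -/
structure IsPoincareEinstein (c : ConformalStructure d M) (I : Tractor c) : Prop where
  parallel : I.IsParallel
  pos_interior : ∀ (g : c.Metric), ∀ x ∈ (𝓡∂ d).interior M, 0 < I.σ g x
  zero_boundary : ∀ (g : c.Metric), ∀ x ∈ (𝓡∂ d).boundary M, I.σ g x = 0
  differential_ne_zero : ∀ (g : c.Metric), ∀ x ∈ (𝓡∂ d).boundary M,
    (differential (I.σ g) x : Covector d x) ≠ 0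
  einstein : ∀ (g : c.Metric), ∀ x ∈ (𝓡∂ d).interior M, ∀ a b,
    ricci (I.plusMetric g) x a b = -((d : ℝ) - 1) * gram (I.plusMetric g) x (base x) a b

/-- The normal tractor `N = (0, n_a, -H)` at a boundary point `x`, as a triple in the scale `g`;
`n` is a covector field extending the unit conormal (for `g`) of the boundary. -/
def normalTractor {c : ConformalStructure d M} (g : c.Metric) (n : CovectorField d M) (x : M) :
    ℝ × Covector d x × ℝ :=
  (0, n x, -meanCurvature g.form n x)

end Conformal

end ConfGeom

end

open scoped Topology
open Filter

namespace ConfGeom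

/-! ### Inverse Gram matrices and the pairing of covectors. -/

section Algebra

variable {ι V : Type*} [Fintype ι] [DecidableEq ι] [AddCommGroup V] [Module ℝ V]

/-! The key fact is that a parallel tractor with `Ric(g₊) = -(d - 1) g₊` has unit length: `|μ|² +
2σρ = 1` on the interior (`IsPoincareEinstein.length_eq_one`). Near an interior point, pass to the
scale `σ⁻² g = g₊`, where the triple is `(1, 0, ρ)`. The middle parallel equation becomes `P = -ρ
g₊`, and the Einstein condition gives `P = -g₊/2`, so `ρ = 1/2`; the rescaling law carries this back
to any scale.

By continuity `|μ| = 1` on the boundary, where `σ = 0`. Since `μ = dσ` and `σ` attains its minimum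
there, `μ` kills tangential vectors and is positive on inward ones. Hence `μ` itself extends the
unit conormal (`IsPoincareEinstein.isUnitConormal`).

At `σ = 0` the middle parallel equation reads `∇μ = -ρ g`. Tracing with `g⁻¹ - n ⊗ n` gives `H =
-ρ`, and tracing with `g⁻¹` gives `Δσ = dρ`. An arbitrary extension of the conormal is handled by
`IsUnitConormal.meanCurvature_eq`: only tangential derivatives enter `H`. -/

/-- If `A` is the invertible Gram matrix of a basis `e` for a bilinear form `B`, then
`A^{ab} B(v, e_a) ν(e_b) = ν(v)`. -/
lemma sum_inv_gram_mul (e : Module.Basis ι ℝ V) (B : V →ₗ[ℝ] V →ₗ[ℝ] ℝ)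
    (A : Matrix ι ι ℝ) (hA : ∀ i j, A i j = B (e i) (e j)) (hdet : IsUnit A.det)
    (v : V) (ν : V →ₗ[ℝ] ℝ) :
    ∑ a, ∑ b, A⁻¹ a b * B v (e a) * ν (e b) = ν v := by
  have hB : ∀ a, B v (e a) = ∑ c, e.repr v c * A c a := by
    intro a
    conv_lhs => rw [← e.sum_repr v]
    simp only [map_sum, map_smul, LinearMap.sum_apply, LinearMap.smul_apply, smul_eq_mul, hA]
  have h1 : ∀ c b, ∑ a, A c a * A⁻¹ a b = if c = b then 1 else 0 := by
    intro c b
    rw [← Matrix.mul_apply, Matrix.mul_nonsing_inv A hdet, Matrix.one_apply]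
  calc ∑ a, ∑ b, A⁻¹ a b * B v (e a) * ν (e b)
      = ∑ b, ∑ c, e.repr v c * ν (e b) * ∑ a, A c a * A⁻¹ a b := by
        rw [Finset.sum_comm]
        refine Finset.sum_congr rfl fun b _ => ?_
        simp_rw [hB, Finset.mul_sum, Finset.sum_mul]
        rw [Finset.sum_comm]
        refine Finset.sum_congr rfl fun c _ => Finset.sum_congr rfl fun a _ => ?_
        ring
    _ = ∑ b, e.repr v b * ν (e b) := by simp [h1]
    _ = ν v := by
        conv_rhs => rw [← e.sum_repr v]
        simp only [map_sum, map_smul, smul_eq_mul]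

/-- A bilinear form with invertible Gram matrix represents every covector. -/
lemma exists_riesz (e : Module.Basis ι ℝ V) (B : V →ₗ[ℝ] V →ₗ[ℝ] ℝ)
    (A : Matrix ι ι ℝ) (hA : ∀ i j, A i j = B (e i) (e j)) (hdet : IsUnit A.det)
    (μ : V →ₗ[ℝ] ℝ) : ∃ v, B v = μ := by
  refine ⟨∑ c, (∑ b, μ (e b) * A⁻¹ b c) • e c, e.ext fun a => ?_⟩
  have h1 : ∀ b, ∑ c, A⁻¹ b c * A c a = if b = a then 1 else 0 := by
    intro b
    rw [← Matrix.mul_apply, Matrix.nonsing_inv_mul A hdet, Matrix.one_apply]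
  simp only [map_sum, map_smul, LinearMap.sum_apply, LinearMap.smul_apply, smul_eq_mul, ← hA,
    Finset.sum_mul]
  rw [Finset.sum_comm]
  simp_rw [mul_assoc, ← Finset.mul_sum, h1]
  simp

/-- The pairing of covectors by the inverse Gram matrix does not depend on the basis. -/
lemma sum_inv_gram_basis_independent (e e' : Module.Basis ι ℝ V) (B : V →ₗ[ℝ] V →ₗ[ℝ] ℝ)
    (A A' : Matrix ι ι ℝ) (hA : ∀ i j, A i j = B (e i) (e j))
    (hA' : ∀ i j, A' i j = B (e' i) (e' j)) (hdet : IsUnit A.det) (hdet' : IsUnit A'.det)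
    (μ ν : V →ₗ[ℝ] ℝ) :
    ∑ a, ∑ b, A⁻¹ a b * μ (e a) * ν (e b) = ∑ a, ∑ b, A'⁻¹ a b * μ (e' a) * ν (e' b) := by
  -- Once `μ` is written as `B v`, both sides equal the basis-free number `ν v`.
  obtain ⟨v, rfl⟩ := exists_riesz e B A hA hdet μ
  rw [sum_inv_gram_mul e B A hA hdet, sum_inv_gram_mul e' B A' hA' hdet']

/-- The Gram matrix of a basis for a positive definite form is invertible. -/
lemma isUnit_det_gram (e : Module.Basis ι ℝ V) (B : V →ₗ[ℝ] V →ₗ[ℝ] ℝ)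
    (hpos : ∀ v, v ≠ 0 → 0 < B v v)
    (A : Matrix ι ι ℝ) (hA : ∀ i j, A i j = B (e i) (e j)) : IsUnit A.det := by
  rw [isUnit_iff_ne_zero]
  intro h0
  obtain ⟨v, hv, hv0⟩ := Matrix.exists_mulVec_eq_zero_iff.2 h0
  have hw : (∑ i, v i • e i) ≠ 0 := by
    intro h
    refine hv (funext fun i => ?_)
    exact Fintype.linearIndependent_iff.1 e.linearIndependent v h i
  have := hpos _ hw
  have h2 : B (∑ i, v i • e i) (∑ i, v i • e i) = ∑ i, v i * (A.mulVec v) i := by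
    simp only [map_sum, map_smul, LinearMap.sum_apply, LinearMap.smul_apply, smul_eq_mul, ← hA,
      Matrix.mulVec, dotProduct, Finset.mul_sum]
    rw [Finset.sum_comm]
    refine Finset.sum_congr rfl fun i _ => Finset.sum_congr rfl fun j _ => by ring
  rw [h2, hv0] at this
  simp at this

end Algebra

/-! ### Coordinate frames and smoothness of components. -/

section Charts

variable {d : ℕ} [NeZero d] {M : Type*} [TopologicalSpace M]
  [ChartedSpace (EuclideanHalfSpace d) M] [IsManifold (𝓡∂ d) ∞ M]

omit [IsManifold (𝓡∂ d) ∞ M] in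
lemma pt_base (p : M) : pt (d := d) p (base p) = p := extChartAt_to_inv (I := 𝓡∂ d) p

omit [IsManifold (𝓡∂ d) ∞ M] in
lemma base_mem_range (p : M) : base p ∈ range (𝓡∂ d) :=
  mem_range_self _

-- The inverse of the model embedding is a continuous retraction of `ℝ^d` onto the half-space, so
-- this holds on full neighbourhoods even at boundary points. Germ arguments can therefore use `𝓝
-- (base p)`.
omit [IsManifold (𝓡∂ d) ∞ M] in
lemma tendsto_pt (p : M) : Tendsto (pt (d := d) p) (𝓝 (base p)) (𝓝 p) := by
  have := continuousAt_extChartAt_symm (I := 𝓡∂ d) p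
  rwa [ContinuousAt, extChartAt_to_inv] at this

omit [IsManifold (𝓡∂ d) ∞ M] in
lemma pt_base_mem_source (p : M) :
    pt p (base (d := d) p) ∈ (chartAt (EuclideanHalfSpace d) p).source := by
  rw [pt_base]
  exact mem_chart_source _ p

/-- The frame of coordinate vector fields of the chart at `p`, at a point `q` of its domain. -/
noncomputable def coordBasis (p q : M) (hq : q ∈ (chartAt (EuclideanHalfSpace d) p).source) :
    Module.Basis (Fin d) ℝ (TangentSpace (𝓡∂ d) q) :=
  (trivializationAt (EuclideanSpace ℝ (Fin d)) (TangentSpace (𝓡∂ d) : M → Type _) p).basisAt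
    (EuclideanSpace.basisFun (Fin d) ℝ).toBasis (by simpa using hq)

lemma coordBasis_apply (p q : M) (hq : q ∈ (chartAt (EuclideanHalfSpace d) p).source)
    (i : Fin d) : coordBasis p q hq i = coordVec p i q := by
  have hq' : q ∈ (trivializationAt (EuclideanSpace ℝ (Fin d))
    (TangentSpace (𝓡∂ d) : M → Type _) p).baseSet := by simpa using hq
  simp [coordBasis, coordVec, Bundle.Trivialization.basisAt,
    Bundle.Trivialization.symmL_apply _ hq']

/-- Links the conditions of `IsUnitConormal`, phrased with vectors of `ℝ^d`, to the coordinate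
frame. -/
lemma coordVec_self (p : M) (i : Fin d) :
    coordVec p i p = (EuclideanSpace.single i 1 : EuclideanSpace ℝ (Fin d)) := by
  rw [coordVec, TangentBundle.symmL_trivializationAt_eq_core (mem_chart_source _ p)]
  exact (tangentBundleCore (𝓡∂ d) M).coordChange_self _ _ (mem_chart_source _ p) _

lemma covector_ext_coordVec {x : M} {μ ν : Covector d x}
    (h : ∀ a, μ (coordVec x a x) = ν (coordVec x a x)) : μ = ν := by
  have := (coordBasis x x (mem_chart_source _ x)).ext (f₁ := μ.toLinearMap) (f₂ := ν.toLinearMap)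
    (fun i => by rw [coordBasis_apply]; exact h i)
  ext v
  exact LinearMap.congr_fun this v

omit [IsManifold (𝓡∂ d) ∞ M] in
lemma eventually_mem_source (p : M) :
    ∀ᶠ y in 𝓝 (base (d := d) p), pt p y ∈ (chartAt (EuclideanHalfSpace d) p).source :=
  (tendsto_pt p).eventually
    ((chartAt (EuclideanHalfSpace d) p).open_source.mem_nhds (mem_chart_source _ p))

lemma contMDiffAt_coordVec (p : M) (i : Fin d) :
    ContMDiffAt (𝓡∂ d) ((𝓡∂ d).prod 𝓘(ℝ, EuclideanSpace ℝ (Fin d))) ∞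
      (fun q => Bundle.TotalSpace.mk' (EuclideanSpace ℝ (Fin d))
        (E := (TangentSpace (𝓡∂ d) : M → Type _)) q (coordVec p i q)) p := by
  have := contMDiffAt_localFrame_of_mem (I := 𝓡∂ d) (n := ∞) (F := EuclideanSpace ℝ (Fin d))
    (V := (TangentSpace (𝓡∂ d) : M → Type _))
    (trivializationAt (EuclideanSpace ℝ (Fin d)) (TangentSpace (𝓡∂ d) : M → Type _) p)
    (EuclideanSpace.basisFun (Fin d) ℝ).toBasis i
    (FiberBundle.mem_baseSet_trivializationAt' p)
  refine this.congr_of_eventuallyEq ?_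
  filter_upwards [(trivializationAt (EuclideanSpace ℝ (Fin d))
    (TangentSpace (𝓡∂ d) : M → Type _) p).open_baseSet.mem_nhds
    (FiberBundle.mem_baseSet_trivializationAt' p)] with q hq
  rw [Bundle.Trivialization.localFrame_apply_of_mem_baseSet _ _ hq]
  simp [coordVec, Bundle.Trivialization.basisAt, Bundle.Trivialization.symmL_apply _ hq]

omit [IsManifold (𝓡∂ d) ∞ M] in
/-- A function smooth at `p` is smooth in the coordinates of the chart at `p`. -/
lemma contDiffWithinAt_comp_pt {f : M → ℝ} {p : M} (hf : ContMDiffAt (𝓡∂ d) 𝓘(ℝ, ℝ) ∞ f p) :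
    ContDiffWithinAt ℝ ∞ (fun y => f (pt p y)) (range (𝓡∂ d)) (base p) := by
  have := (contMDiffAt_iff.1 hf).2
  simpa [Function.comp_def] using! this

lemma contMDiffAt_apply_coordVec {μ : CovectorField d M} (hμ : μ.Smooth) (p : M) (i : Fin d) :
    ContMDiffAt (𝓡∂ d) 𝓘(ℝ, ℝ) ∞ (fun q => μ q (coordVec p i q)) p := by
  have := ContMDiffAt.clm_bundle_apply (E₂ := Bundle.Trivial M ℝ) (F₂ := ℝ) (b := fun q => q)
    (hμ p) (contMDiffAt_coordVec p i)
  exact (Bundle.contMDiffAt_totalSpace.1 this).2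

lemma contDiffWithinAt_covComp {μ : CovectorField d M} (hμ : μ.Smooth) (p : M) (i : Fin d) :
    ContDiffWithinAt ℝ ∞ (covComp μ p i) (range (𝓡∂ d)) (base p) :=
  contDiffWithinAt_comp_pt (contMDiffAt_apply_coordVec hμ p i)

end Charts

/-! ### Components of a metric and of its inverse. -/

section Metric

variable {d : ℕ} [NeZero d] {M : Type*} [TopologicalSpace M]
  [ChartedSpace (EuclideanHalfSpace d) M] [IsManifold (𝓡∂ d) ∞ M]

lemma contDiffWithinAt_gram (g : SmoothMetric d M) (p : M) (i j : Fin d) :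
    ContDiffWithinAt ℝ ∞ (fun y => gram (fun x => g.inner x) p y i j) (range (𝓡∂ d))
      (base p) := by
  have := ContMDiffAt.clm_bundle_apply₂ (E₃ := Bundle.Trivial M ℝ) (F₃ := ℝ) (b := fun q => q)
    (g.contMDiff p) (contMDiffAt_coordVec p i) (contMDiffAt_coordVec p j)
  refine contDiffWithinAt_comp_pt (f := fun q => g.inner q (coordVec p i q) (coordVec p j q)) ?_
  exact (Bundle.contMDiffAt_totalSpace.1 this).2

end Metric

section MetricAlgebra

variable {d : ℕ} [NeZero d] {M : Type*} [TopologicalSpace M]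
  [ChartedSpace (EuclideanHalfSpace d) M] [IsManifold (𝓡∂ d) ∞ M]

/-- A bilinear field as a bilinear form on each tangent space. -/
noncomputable def bilinAt (G : BilinField d M) (x : M) :
    TangentSpace (𝓡∂ d) x →ₗ[ℝ] TangentSpace (𝓡∂ d) x →ₗ[ℝ] ℝ :=
  LinearMap.mk₂ ℝ (fun v w => G x v w) (by simp) (by simp) (by simp) (by simp)

variable (g : SmoothMetric d M)

lemma gram_eq_bilinAt (G : BilinField d M) {p : M} {y : EuclideanSpace ℝ (Fin d)}
    (hy : pt p y ∈ (chartAt (EuclideanHalfSpace d) p).source) (i j : Fin d) :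
    gram G p y i j = bilinAt G (pt p y) (coordBasis p _ hy i) (coordBasis p _ hy j) := by
  rw [coordBasis_apply, coordBasis_apply]
  rfl

lemma isUnit_det_gram_metric {p : M} {y : EuclideanSpace ℝ (Fin d)}
    (hy : pt p y ∈ (chartAt (EuclideanHalfSpace d) p).source) :
    IsUnit (gram (fun x => g.inner x) p y).det :=
  isUnit_det_gram (coordBasis p _ hy) (bilinAt (fun x => g.inner x) _)
    (fun v hv => g.pos _ v hv) _ (gram_eq_bilinAt _ hy)

lemma gram_symm (p : M) (y : EuclideanSpace ℝ (Fin d)) :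
    (gram (fun x => g.inner x) p y).transpose = gram (fun x => g.inner x) p y := by
  ext i j
  exact g.symm _ _ _

lemma gramInv_symm (p : M) (y : EuclideanSpace ℝ (Fin d)) (i j : Fin d) :
    gramInv (fun x => g.inner x) p y i j = gramInv (fun x => g.inner x) p y j i := by
  rw [← Matrix.transpose_apply (gramInv _ p y), gramInv, Matrix.transpose_nonsing_inv, gram_symm]

/-- The trace of the metric is the dimension. -/
lemma sum_gramInv_mul_gram (p : M) :
    ∑ a, ∑ b, gramInv (fun x => g.inner x) p (base p) a b
      * gram (fun x => g.inner x) p (base p) a b = d := by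
  have h1 : ∀ a, ∑ b, gramInv (fun x => g.inner x) p (base p) a b
      * gram (fun x => g.inner x) p (base p) a b = 1 := by
    intro a
    have : ∀ b, gram (fun x => g.inner x) p (base p) a b
        = gram (fun x => g.inner x) p (base p) b a := fun b => g.symm _ _ _
    simp_rw [this]
    rw [← Matrix.mul_apply, gramInv,
      Matrix.nonsing_inv_mul _ (isUnit_det_gram_metric g (pt_base_mem_source p)),
      Matrix.one_apply_eq]
  simp [h1]

/-- The inner product of covectors may be computed in any chart. -/
lemma covInner_eq_in_chart {p : M} {y : EuclideanSpace ℝ (Fin d)}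
    (hy : pt p y ∈ (chartAt (EuclideanHalfSpace d) p).source) (μ ν : Covector d (pt p y)) :
    covInner (fun x => g.inner x) (pt p y) μ ν
      = ∑ a, ∑ b, gramInv (fun x => g.inner x) p y a b * μ (coordVec p a (pt p y))
          * ν (coordVec p b (pt p y)) := by
  have hq := mem_chart_source (EuclideanHalfSpace d) (pt p y)
  have hb := pt_base (d := d) (pt p y)
  have := sum_inv_gram_basis_independent (coordBasis (pt p y) _ hq) (coordBasis p _ hy)
    (bilinAt (fun x => g.inner x) (pt p y)) (gram (fun x => g.inner x) (pt p y) (base (pt p y)))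
    (gram (fun x => g.inner x) p y) (fun i j => ?_) (gram_eq_bilinAt _ hy)
    (isUnit_det_gram_metric g (pt_base_mem_source _)) (isUnit_det_gram_metric g hy)
    μ.toLinearMap ν.toLinearMap
  · simpa [coordBasis_apply, covInner, gramInv] using this
  · rw [coordBasis_apply, coordBasis_apply]
    change g.inner (pt (pt p y) (base (pt p y))) _ _ = g.inner _ _ _
    rw [hb]

end MetricAlgebra

/-! ### Curvature depends only on the germ of the metric. -/

section Locality

variable {d : ℕ} [NeZero d] {M : Type*} [TopologicalSpace M]
  [ChartedSpace (EuclideanHalfSpace d) M] [IsManifold (𝓡∂ d) ∞ M]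

lemma pderiv_congr {f f' : EuclideanSpace ℝ (Fin d) → ℝ} {y : EuclideanSpace ℝ (Fin d)}
    (h : f =ᶠ[𝓝 y] f') (i : Fin d) : pderiv i f y = pderiv i f' y := by
  rw [pderiv, pderiv, (h.filter_mono nhdsWithin_le_nhds).fderivWithin_eq h.self_of_nhds]

lemma pderiv_eventuallyEq {f f' : EuclideanSpace ℝ (Fin d) → ℝ} {y : EuclideanSpace ℝ (Fin d)}
    (h : f =ᶠ[𝓝 y] f') (i : Fin d) : pderiv i f =ᶠ[𝓝 y] pderiv i f' := by
  filter_upwards [eventually_eventually_nhds.2 h] with z hz using pderiv_congr hz i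

lemma gram_eventuallyEq {G G' : BilinField d M} {p : M} (h : ∀ᶠ x in 𝓝 p, G x = G' x) :
    gram G p =ᶠ[𝓝 (base p)] gram G' p := by
  filter_upwards [(tendsto_pt p).eventually h] with y hy
  ext i j
  simp [gram, hy]

lemma christoffel_eventuallyEq {G G' : BilinField d M} {p : M} (h : ∀ᶠ x in 𝓝 p, G x = G' x)
    (k i j : Fin d) : christoffel G p k i j =ᶠ[𝓝 (base p)] christoffel G' p k i j := by
  have hg := gram_eventuallyEq h
  have hd : ∀ a b c, (pderiv a fun z => gram G p z b c) =ᶠ[𝓝 (base p)]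
      (pderiv a fun z => gram G' p z b c) := fun a b c =>
    pderiv_eventuallyEq (hg.mono fun y hy => by simp only [hy]) a
  have h1 := eventually_all.2 fun l => hd i j l
  have h2 := eventually_all.2 fun l => hd j i l
  have h3 := eventually_all.2 fun l => hd l i j
  filter_upwards [hg, h1, h2, h3] with y hy h1 h2 h3
  simp only [christoffel, gramInv, hy, h1, h2, h3]

/-- The Ricci tensor at `p` depends only on the germ of the metric at `p`. -/
lemma ricci_congr {G G' : BilinField d M} {p : M} (h : ∀ᶠ x in 𝓝 p, G x = G' x)
    (a b : Fin d) : ricci G p a b = ricci G' p a b := by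
  have hc := fun k i j => christoffel_eventuallyEq h k i j
  have hv : ∀ k i j, christoffel G p k i j (base p) = christoffel G' p k i j (base p) :=
    fun k i j => (hc k i j).self_of_nhds
  have hp : ∀ l k i j, pderiv l (christoffel G p k i j) (base p)
      = pderiv l (christoffel G' p k i j) (base p) := fun l k i j => pderiv_congr (hc k i j) l
  simp only [ricci, hv, hp]

end Locality

/-! ### Changes of scale. -/

section Rescaling

variable {d : ℕ} [NeZero d] {M : Type*} [TopologicalSpace M]
  [ChartedSpace (EuclideanHalfSpace d) M] [IsManifold (𝓡∂ d) ∞ M]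

/-- The metric `e^{2u} g`. -/
noncomputable def SmoothMetric.rescale (g : SmoothMetric d M) (u : M → ℝ)
    (hu : ContMDiff (𝓡∂ d) 𝓘(ℝ, ℝ) ∞ u) : SmoothMetric d M where
  inner x := Real.exp (2 * u x) • g.inner x
  symm x v w := by
    change Real.exp (2 * u x) * g.inner x v w = Real.exp (2 * u x) * g.inner x w v
    rw [g.symm]
  pos x v hv := mul_pos (Real.exp_pos _) (g.pos x v hv)
  isVonNBounded x := by
    -- The unit ball of `e^{2u} g` is the unit ball of `g` scaled by `e^{-u}`.
    have h := (g.isVonNBounded x).image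
      ((Real.exp (-u x)) • ContinuousLinearMap.id ℝ (TangentSpace (𝓡∂ d) x))
    refine h.subset fun v hv => (Set.mem_image _ _ _).2 ⟨Real.exp (u x) • v, ?_, ?_⟩
    · have hv' : Real.exp (2 * u x) * g.inner x v v < 1 := hv
      change g.inner x (Real.exp (u x) • v) (Real.exp (u x) • v) < 1
      rw [two_mul, Real.exp_add] at hv'
      simpa [mul_assoc] using hv'
    · simp [smul_smul, ← Real.exp_add]
  contMDiff := by
    have hf : ContMDiff (𝓡∂ d) 𝓘(ℝ, ℝ) ∞ (fun x => Real.exp (2 * u x)) :=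
      (Real.contDiff_exp.contMDiff).comp (contMDiff_const.mul hu)
    exact ContMDiff.smul_section
      (F := EuclideanSpace ℝ (Fin d) →L[ℝ] EuclideanSpace ℝ (Fin d) →L[ℝ] ℝ)
      (V := fun x : M => TangentSpace (𝓡∂ d) x →L[ℝ] TangentSpace (𝓡∂ d) x →L[ℝ] ℝ) hf g.contMDiff

lemma SmoothMetric.isRescaling_rescale (g : SmoothMetric d M) (u : M → ℝ)
    (hu : ContMDiff (𝓡∂ d) 𝓘(ℝ, ℝ) ∞ u) : IsRescaling g (g.rescale u hu) u :=
  ⟨hu, fun _ _ _ => rfl⟩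

/-- The rescaling laws of a tractor compare scales on all of `M`, so a local change of scale has to
come from a globally smooth `u`. -/
lemma ConformalStructure.Metric.exists_rescaling {c : ConformalStructure d M} (g : c.Metric)
    (u : M → ℝ) (hu : ContMDiff (𝓡∂ d) 𝓘(ℝ, ℝ) ∞ u) :
    ∃ g' : c.Metric, IsRescaling g.1 g'.1 u := by
  refine ⟨⟨g.1.rescale u hu, ?_⟩, g.1.isRescaling_rescale u hu⟩
  exact (Quotient.sound (s := conformalSetoid d M) ⟨u, g.1.isRescaling_rescale u hu⟩).symm.trans g.2

end Rescaling

/-- A smooth function on the line that agrees with `-log` on `(ε / 2, ∞)`. -/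
lemma exists_contDiff_eq_neg_log {ε : ℝ} (hε : 0 < ε) :
    ∃ φ : ℝ → ℝ, ContDiff ℝ ∞ φ ∧ ∀ t, ε / 2 < t → φ t = -Real.log t := by
  -- The cutoff `s` is `0` for `t ≤ ε/4` and `1` for `t ≥ ε/2`. So `t s + (1 - s)` is `1` on the
  -- first range and a convex combination of the positive numbers `t` and `1` beyond it; its
  -- logarithm is smooth everywhere.
  let s : ℝ → ℝ := fun t => Real.smoothTransition (4 / ε * t - 1)
  have hs : ContDiff ℝ ∞ s :=
    Real.smoothTransition.contDiff.comp ((contDiff_const.mul contDiff_id).sub contDiff_const)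
  refine ⟨fun t => -Real.log (t * s t + (1 - s t)), ?_, fun t ht => ?_⟩
  · refine (ContDiff.log ((contDiff_id.mul hs).add (contDiff_const.sub hs)) fun t => ?_).neg
    have h0 : 0 ≤ s t := Real.smoothTransition.nonneg _
    have h1 : s t ≤ 1 := Real.smoothTransition.le_one _
    rcases le_or_gt t (ε / 4) with h | h
    · have : s t = 0 := by
        apply Real.smoothTransition.zero_of_nonpos
        have : 4 / ε * t ≤ 4 / ε * (ε / 4) := by gcongr
        have h4 : 4 / ε * (ε / 4) = 1 := by field_simp
        linarith
      simp [this]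
    · have ht : 0 < t := by linarith
      rcases h0.eq_or_lt with h0 | h0
      · simp [← h0]
      · have := mul_pos ht h0
        simp only [id]
        linarith
  · have : s t = 1 := by
      apply Real.smoothTransition.one_of_one_le
      have : 4 / ε * (ε / 2) ≤ 4 / ε * t := by gcongr
      have h4 : 4 / ε * (ε / 2) = 2 := by field_simp; norm_num
      linarith
    simp [this]

/-! ### Chain rule and bilinearity. -/

section Differential

variable {d : ℕ} [NeZero d] {M : Type*} [TopologicalSpace M]
  [ChartedSpace (EuclideanHalfSpace d) M]

lemma differential_comp {φ : ℝ → ℝ} {f : M → ℝ} {x : M} {φ' : ℝ}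
    (hφ : HasDerivAt φ φ' (f x)) (hf : MDifferentiableAt (𝓡∂ d) 𝓘(ℝ, ℝ) f x) :
    differential (d := d) (fun z => φ (f z)) x = φ' • differential f x := by
  have h := (hφ.hasFDerivAt.hasMFDerivAt.comp x hf.hasMFDerivAt).mfderiv
  ext v
  have h2 := congrArg (fun L => L v) h
  refine h2.trans ?_
  exact mul_comm (differential f x v) φ'

end Differential

section CovInner

variable {d : ℕ} [NeZero d] {M : Type*} [TopologicalSpace M]
  [ChartedSpace (EuclideanHalfSpace d) M] [IsManifold (𝓡∂ d) ∞ M]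

lemma covInner_smul_left (G : BilinField d M) (p : M) (r : ℝ) (μ ν : Covector d p) :
    covInner G p (r • μ) ν = r * covInner G p μ ν := by
  simp only [covInner, Finset.mul_sum, smul_apply, smul_eq_mul]
  exact Finset.sum_congr rfl fun a _ => Finset.sum_congr rfl fun b _ => by ring

lemma covInner_smul_right (G : BilinField d M) (p : M) (r : ℝ) (μ ν : Covector d p) :
    covInner G p μ (r • ν) = r * covInner G p μ ν := by
  simp only [covInner, Finset.mul_sum, smul_apply, smul_eq_mul]
  exact Finset.sum_congr rfl fun a _ => Finset.sum_congr rfl fun b _ => by ring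

end CovInner

/-! ### Unit length of the tractor on the interior. -/

section Parallel

variable {d : ℕ} [NeZero d] {M : Type*} [TopologicalSpace M]
  [ChartedSpace (EuclideanHalfSpace d) M] [IsManifold (𝓡∂ d) ∞ M]
  {c : ConformalStructure d M} {I : Tractor c}

lemma Tractor.IsParallel.μ_eq (hI : I.IsParallel) (g : c.Metric) :
    I.μ g = differential (I.σ g) :=
  funext fun x => covector_ext_coordVec fun a => (sub_eq_zero.1 ((hI g x).1 a)).symm

lemma covDeriv_eq_zero {G : BilinField d M} {μ : CovectorField d M} {p : M}
    (h : ∀ᶠ x in 𝓝 p, μ x = 0) (a b : Fin d) : covDeriv G μ p a b = 0 := by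
  have hc : ∀ b, covComp μ p b =ᶠ[𝓝 (base p)] fun _ => 0 := by
    intro b
    filter_upwards [(tendsto_pt p).eventually h] with y hy
    simp [covComp, hy]
  have h0 : ∀ b, covComp μ p b (base p) = 0 := fun b => (hc b).self_of_nhds
  rw [covDeriv, pderiv_congr (hc b)]
  simp [h0, pderiv]

/-- If in some scale a tractor is parallel and near `p` its triple is `(1, 0, ρ)`, and if moreover
`Ric = -(d - 1) g` at `p`, then `ρ = 1/2` at `p`. -/
lemma rho_eq_half_of_einstein (hd : 3 ≤ d) (hI : I.IsParallel) (g : c.Metric) (p : M)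
    (hσ : I.σ g p = 1) (hμ : ∀ᶠ x in 𝓝 p, I.μ g x = 0)
    (hE : ∀ a b, ricci g.form p a b = -((d : ℝ) - 1) * gram g.form p (base p) a b) :
    I.ρ g p = 1 / 2 := by
  have hd' : (3 : ℝ) ≤ d := by exact_mod_cast hd
  -- `Scal = -d(d - 1)`, hence `J = -d/2` and `P = -g/2`.
  have hJ : schoutenTrace g.form p = -(d : ℝ) / 2 := by
    have h1 : ∑ a, ∑ b, gramInv g.form p (base p) a b * gram g.form p (base p) a b = d :=
      sum_gramInv_mul_gram g.1 p
    have h2 : ∑ a, ∑ b, gramInv g.form p (base p) a b * ricci g.form p a b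
        = -((d : ℝ) - 1) * ∑ a, ∑ b, gramInv g.form p (base p) a b * gram g.form p (base p) a b := by
      simp only [hE, Finset.mul_sum]
      exact Finset.sum_congr rfl fun a _ => Finset.sum_congr rfl fun b _ => by ring
    rw [schoutenTrace, h2, h1]
    have : (d : ℝ) - 1 ≠ 0 := by linarith
    field_simp
  -- The equation is now `ρ g + P = 0` with `P = -g/2`; one diagonal component suffices because
  -- `g_{00} > 0`.
  have h := (hI g p).2.1 0 0
  rw [covDeriv_eq_zero hμ, hσ, schouten, hE, hJ] at h
  have hpos : 0 < gram g.form p (base p) 0 0 := by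
    refine g.1.pos _ _ ?_
    rw [← coordBasis_apply p _ (pt_base_mem_source p)]
    exact (coordBasis p _ _).ne_zero 0
  have hd2 : (d : ℝ) - 2 ≠ 0 := by linarith
  field_simp at h
  have h3 : gram g.form p (base p) 0 0 * ((d : ℝ) - 2) * (2 * I.ρ g p - 1) = 0 := by
    linear_combination h
  have := (mul_eq_zero.1 h3).resolve_left (mul_ne_zero hpos.ne' hd2)
  linarith

/-- On the interior of a Poincaré–Einstein manifold the tractor has unit length:
`|μ|² + 2 σ ρ = 1`. -/
lemma IsPoincareEinstein.length_eq_one (hd : 3 ≤ d) (hI : IsPoincareEinstein c I) (g : c.Metric)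
    {p : M} (hp : p ∈ (𝓡∂ d).interior M) :
    covInner g.form p (I.μ g p) (I.μ g p) + 2 * I.σ g p * I.ρ g p = 1 := by
  have hε := hI.pos_interior g p hp
  set ε := I.σ g p with hεdef
  -- The wanted factor `u = -log σ` blows up at the boundary. Replacing it by `φ ∘ σ` changes
  -- nothing near `p` and is smooth on `M`.
  obtain ⟨φ, hφ, hφlog⟩ := exists_contDiff_eq_neg_log hε
  have hu : ContMDiff (𝓡∂ d) 𝓘(ℝ, ℝ) ∞ (fun x => φ (I.σ g x)) :=
    hφ.contMDiff.comp (I.smooth_σ g)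
  obtain ⟨g', hg'⟩ := g.exists_rescaling _ hu
  have hnear : ∀ᶠ x in 𝓝 p, ε / 2 < I.σ g x :=
    (I.smooth_σ g).continuous.continuousAt.eventually (lt_mem_nhds (by linarith))
  have hexp : ∀ x, ε / 2 < I.σ g x → Real.exp (φ (I.σ g x)) = (I.σ g x)⁻¹ := by
    intro x hx
    rw [hφlog _ hx, Real.exp_neg, Real.exp_log (by linarith)]
  have hdu : ∀ x, ε / 2 < I.σ g x →
      differential (fun z => φ (I.σ g z)) x = -(I.σ g x)⁻¹ • I.μ g x := by
    intro x hx
    rw [hI.parallel.μ_eq g]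
    refine differential_comp ?_ ((I.smooth_σ g x).mdifferentiableAt (by simp))
    refine (Real.hasDerivAt_log (by linarith : I.σ g x ≠ 0)).neg.congr_of_eventuallyEq ?_
    filter_upwards [lt_mem_nhds hx] with t ht using hφlog t ht
  have hp2 : ε / 2 < I.σ g p := by linarith
  have hσ' : I.σ g' p = 1 := by
    rw [I.rescale_σ g g' _ hg', hexp p hp2]
    exact inv_mul_cancel₀ hε.ne'
  have hμ' : ∀ᶠ x in 𝓝 p, I.μ g' x = 0 := by
    filter_upwards [hnear] with x hx
    have : I.σ g x ≠ 0 := by linarith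
    rw [I.rescale_μ g g' _ hg', hdu x hx, smul_smul, mul_neg, mul_inv_cancel₀ this, neg_one_smul ℝ (I.μ g x),
      add_neg_cancel, smul_zero]
  have hform : ∀ᶠ x in 𝓝 p, I.plusMetric g x = g'.form x := by
    filter_upwards [hnear] with x hx
    ext v w
    have := hg'.2 x v w
    rw [two_mul, Real.exp_add, hexp x hx, ← mul_inv, ← sq] at this
    exact this.symm
  have hE : ∀ a b, ricci g'.form p a b = -((d : ℝ) - 1) * gram g'.form p (base p) a b := by
    intro a b
    rw [← ricci_congr hform, ← (gram_eventuallyEq hform).self_of_nhds]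
    exact hI.einstein g p hp a b
  have hρ := rho_eq_half_of_einstein hd hI.parallel g' p hσ' hμ' hE
  -- With `Υ = -σ⁻¹ μ` and `e^{-u} = σ` the law reads `1/2 = σ (ρ + σ⁻¹|μ|² - ½ σ⁻¹|μ|²) = σρ +
  -- ½|μ|²`.
  rw [I.rescale_ρ g g' _ hg', Real.exp_neg, hexp p hp2, inv_inv, hdu p hp2, covInner_smul_left,
    covInner_smul_left, covInner_smul_right, ← hεdef] at hρ
  field_simp at hρ
  linear_combination hρ

end Parallel

/-! ### First-order calculus at the edge of the half-space. -/

section HalfSpace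

variable {d : ℕ} [NeZero d]

lemma mem_posTangentCone_range {b v : EuclideanSpace ℝ (Fin d)} (hb : 0 ≤ b 0) (hv : 0 ≤ v 0) :
    v ∈ posTangentConeAt (range (𝓡∂ d)) b := by
  refine mem_posTangentConeAt_of_segment_subset ?_
  rw [range_modelWithCornersEuclideanHalfSpace]
  exact (EuclideanHalfSpace.convex (n := d)).segment_subset hb (by simpa using add_nonneg hb hv)

lemma mem_posTangentCone_hyperplane {b v : EuclideanSpace ℝ (Fin d)} (hb : b 0 = 0)
    (hv : v 0 = 0) : v ∈ posTangentConeAt {y : EuclideanSpace ℝ (Fin d) | y 0 = 0} b := by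
  refine mem_posTangentConeAt_of_frequently_mem (Eventually.frequently ?_)
  exact Eventually.of_forall fun t => by simp [hb, hv]

/-- Tangential derivatives at a point of the bounding hyperplane depend only on the restriction to
the hyperplane. -/
lemma pderiv_eq_of_eq_on_hyperplane {f f' : EuclideanSpace ℝ (Fin d) → ℝ}
    {b : EuclideanSpace ℝ (Fin d)} (hb : b 0 = 0)
    (hf : DifferentiableWithinAt ℝ f (range (𝓡∂ d)) b)
    (hf' : DifferentiableWithinAt ℝ f' (range (𝓡∂ d)) b)
    (h : ∀ᶠ y in 𝓝[{y : EuclideanSpace ℝ (Fin d) | y 0 = 0}] b, f y = f' y) {a : Fin d}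
    (ha : a ≠ 0) : pderiv a f b = pderiv a f' b := by
  have hsub : {y : EuclideanSpace ℝ (Fin d) | y 0 = 0} ⊆ range (𝓡∂ d) := by
    rw [range_modelWithCornersEuclideanHalfSpace]
    exact fun y hy => (show y 0 = 0 from hy).ge
  have hd := (hf.hasFDerivWithinAt.sub hf'.hasFDerivWithinAt).mono hsub
  -- `f - f'` vanishes on the hyperplane near `b`, so `b` is trivially a local minimum there. Both
  -- `±∂_a` lie in the tangent cone, so Fermat's rule makes the derivative along `∂_a` zero.
  have hmin : IsLocalMinOn (fun y => f y - f' y) {y : EuclideanSpace ℝ (Fin d) | y 0 = 0} b := by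
    have hb' : f b = f' b := h.self_of_nhdsWithin hb
    filter_upwards [h] with y hy
    simp [hy, hb']
  have h0 : (EuclideanSpace.single a (1 : ℝ) : EuclideanSpace ℝ (Fin d)) 0 = 0 := by
    simp [ha.symm]
  have := hmin.hasFDerivWithinAt_eq_zero hd (mem_posTangentCone_hyperplane hb h0)
    (mem_posTangentCone_hyperplane hb (by simpa using h0))
  exact sub_eq_zero.1 this

lemma apply_eq_mul_of_tangent_eq_zero (L : EuclideanSpace ℝ (Fin d) →L[ℝ] ℝ)
    (hL : ∀ v : EuclideanSpace ℝ (Fin d), v 0 = 0 → L v = 0) (v : EuclideanSpace ℝ (Fin d)) :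
    L v = v 0 * L (EuclideanSpace.single 0 1) := by
  have := hL (v - v 0 • EuclideanSpace.single 0 1) (by simp)
  rw [map_sub, map_smul, smul_eq_mul] at this
  linarith

end HalfSpace

/-! ### Boundary and interior in a chart; limits from the interior. -/

section Boundary

variable {d : ℕ} [NeZero d] {M : Type*} [TopologicalSpace M]
  [ChartedSpace (EuclideanHalfSpace d) M]

lemma base_zero_of_mem_boundary {x : M} (hx : x ∈ (𝓡∂ d).boundary M) : base (d := d) x 0 = 0 := by
  have h : base (d := d) x ∈ frontier (range (𝓡∂ d)) := hx
  rw [frontier_range_modelWithCornersEuclideanHalfSpace] at h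
  exact Eq.symm h

variable [IsManifold (𝓡∂ d) ∞ M]

/-- In any chart the interior is given by `y 0 > 0`. -/
lemma pt_mem_interior_iff {p : M} {y : EuclideanSpace ℝ (Fin d)}
    (hy : y ∈ (extChartAt (𝓡∂ d) p).target) : pt p y ∈ (𝓡∂ d).interior M ↔ 0 < y 0 := by
  have hs : pt p y ∈ (chartAt (EuclideanHalfSpace d) p).source := by
    rw [← extChartAt_source (𝓡∂ d)]
    exact (extChartAt (𝓡∂ d) p).map_target hy
  have hr : (chartAt (EuclideanHalfSpace d) p).extend (𝓡∂ d) (pt p y) = y :=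
    (extChartAt (𝓡∂ d) p).right_inv hy
  -- An interior point is defined through its own preferred chart; chart independence moves the test
  -- to the chart at `p`.
  have h1 := (𝓡∂ d).isInteriorPoint_iff_of_mem_atlas (n := ∞) (by simp)
    (chart_mem_atlas (EuclideanHalfSpace d) p) hs
  have h2 : y ∈ interior (range (𝓡∂ d)) ↔ 0 < y 0 := by
    rw [interior_range_modelWithCornersEuclideanHalfSpace]
    rfl
  rw [← h2]
  refine h1.trans ⟨fun h => ?_, fun h => ?_⟩
  · rw [hr] at h
    exact OpenPartialHomeomorph.interior_extend_target_subset_interior_range _ h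
  · refine (chartAt (EuclideanHalfSpace d) p).mem_interior_extend_target
      ((chartAt (EuclideanHalfSpace d) p).map_source hs) ?_
    change (chartAt (EuclideanHalfSpace d) p).extend (𝓡∂ d) (pt p y) ∈ _
    rwa [hr]

lemma pt_mem_boundary_iff {p : M} {y : EuclideanSpace ℝ (Fin d)}
    (hy : y ∈ (extChartAt (𝓡∂ d) p).target) : pt p y ∈ (𝓡∂ d).boundary M ↔ y 0 = 0 := by
  have hy0 : 0 ≤ y 0 := by
    have := extChartAt_target_subset_range p hy
    rwa [range_modelWithCornersEuclideanHalfSpace] at this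
  rw [← (𝓡∂ d).compl_interior, mem_compl_iff, pt_mem_interior_iff hy, not_lt]
  exact ⟨fun h => le_antisymm h hy0, fun h => h.le⟩

lemma eventually_pt_mem_boundary {p : M} :
    ∀ᶠ y in 𝓝[{y : EuclideanSpace ℝ (Fin d) | y 0 = 0}] (base p),
      pt p y ∈ (𝓡∂ d).boundary M := by
  have hsub : {y : EuclideanSpace ℝ (Fin d) | y 0 = 0} ⊆ range (𝓡∂ d) := by
    rw [range_modelWithCornersEuclideanHalfSpace]
    exact fun y hy => (show y 0 = 0 from hy).ge
  filter_upwards [nhdsWithin_mono _ hsub (extChartAt_target_mem_nhdsWithin p),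
    self_mem_nhdsWithin] with y hy hy0 using (pt_mem_boundary_iff hy).2 hy0

/-- A function continuous up to a boundary point and constant on the interior has the same value
there. -/
lemma eq_of_tendsto_of_eq_on_interior {p : M} {F : EuclideanSpace ℝ (Fin d) → ℝ} {r : ℝ}
    (hF : ContinuousWithinAt F (range (𝓡∂ d)) (base p))
    (h : ∀ᶠ y in 𝓝 (base p), pt p y ∈ (𝓡∂ d).interior M → F y = r) : F (base p) = r := by
  -- The half-space lies in the closure of its interior, so limits from the interior are unique.
  have hne : (𝓝[interior (range (𝓡∂ d))] (base p)).NeBot :=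
    mem_closure_iff_nhdsWithin_neBot.1
      ((𝓡∂ d).range_subset_closure_interior (base_mem_range p))
  have hF' := hF.mono_left (nhdsWithin_mono (base p) (interior_subset (s := range (𝓡∂ d))))
  refine tendsto_nhds_unique hF' (tendsto_const_nhds.congr' ?_)
  filter_upwards [nhdsWithin_mono _ interior_subset (extChartAt_target_mem_nhdsWithin p),
    self_mem_nhdsWithin, nhdsWithin_le_nhds h] with y hy hy0 hyF
  refine (hyF ((pt_mem_interior_iff hy).2 ?_)).symm
  rwa [interior_range_modelWithCornersEuclideanHalfSpace] at hy0

/-- Cramer's rule: the inverse is the adjugate over a determinant that is nonzero at `base p`. -/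
lemma continuousWithinAt_gramInv (g : SmoothMetric d M) (p : M) (i j : Fin d) :
    ContinuousWithinAt (fun y => gramInv (fun x => g.inner x) p y i j) (range (𝓡∂ d))
      (base p) := by
  have hm : ContinuousWithinAt (fun y => gram (fun x => g.inner x) p y) (range (𝓡∂ d))
      (base p) :=
    continuousWithinAt_pi.2 fun i => continuousWithinAt_pi.2 fun j =>
      (contDiffWithinAt_gram g p i j).continuousWithinAt
  have hdet := (isUnit_det_gram_metric g (pt_base_mem_source p)).ne_zero
  have hinv : ContinuousAt (fun A : Matrix (Fin d) (Fin d) ℝ => A⁻¹ i j)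
      (gram (fun x => g.inner x) p (base p)) := by
    simp only [Matrix.inv_def, Ring.inverse_eq_inv', Matrix.smul_apply, smul_eq_mul]
    refine ContinuousAt.mul (ContinuousAt.inv₀ ?_ hdet) ?_
    · exact (continuous_id.matrix_det).continuousAt
    · exact (continuous_id.matrix_adjugate.matrix_elem i j).continuousAt
  exact hinv.comp_continuousWithinAt hm

omit [IsManifold (𝓡∂ d) ∞ M] in
lemma differential_apply {f : M → ℝ} {p : M} (hf : MDifferentiableAt (𝓡∂ d) 𝓘(ℝ, ℝ) f p)
    (v : EuclideanSpace ℝ (Fin d)) :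
    differential (d := d) f p v
      = fderivWithin ℝ (fun y => f (pt p y)) (range (𝓡∂ d)) (base p) v :=
  DFunLike.congr_fun hf.mfderiv v

end Boundary

/-! ### Uniqueness of the unit conormal along the boundary. -/

section Conormal

variable {d : ℕ} [NeZero d] {M : Type*} [TopologicalSpace M]
  [ChartedSpace (EuclideanHalfSpace d) M] [IsManifold (𝓡∂ d) ∞ M]

/-- A covector annihilating the tangent vectors of the boundary has squared length `G^{00} ν_0²`. -/
lemma covInner_self_of_tangent (G : BilinField d M) (x : M) (ν : Covector d x)
    (h : ∀ a, a ≠ 0 → ν (coordVec x a x) = 0) :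
    covInner G x ν ν = gramInv G x (base x) 0 0 * ν (coordVec x 0 x) ^ 2 := by
  rw [covInner, Finset.sum_eq_single 0, Finset.sum_eq_single 0]
  · ring
  · intro b _ hb
    rw [h b hb, mul_zero]
  · simp
  · intro a _ ha
    simp [h a ha]
  · simp

variable {G : BilinField d M} {n n' : CovectorField d M}

lemma IsUnitConormal.apply_coordVec (hn : IsUnitConormal G n) {x : M}
    (hx : x ∈ (𝓡∂ d).boundary M) (a : Fin d) (ha : a ≠ 0) : n x (coordVec x a x) = 0 := by
  rw [coordVec_self]
  exact hn.tangent x hx _ (by simp [ha.symm])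

lemma IsUnitConormal.gramInv_mul_sq (hn : IsUnitConormal G n) {x : M}
    (hx : x ∈ (𝓡∂ d).boundary M) :
    gramInv G x (base x) 0 0 * n x (coordVec x 0 x) ^ 2 = 1 := by
  rw [← hn.unit x hx, covInner_self_of_tangent G x _ (hn.apply_coordVec hx)]

lemma IsUnitConormal.apply_coordVec_zero_pos (hn : IsUnitConormal G n) {x : M}
    (hx : x ∈ (𝓡∂ d).boundary M) : 0 < n x (coordVec x 0 x) := by
  rw [coordVec_self]
  exact hn.inward x hx _ (by simp)

/-- The unit conormal is determined along the boundary. -/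
lemma IsUnitConormal.eq_on_boundary (hn : IsUnitConormal G n) (hn' : IsUnitConormal G n')
    {x : M} (hx : x ∈ (𝓡∂ d).boundary M) : n x = n' x := by
  refine covector_ext_coordVec fun a => ?_
  by_cases ha : a = 0
  · subst ha
    have h := hn.gramInv_mul_sq hx
    have h' := hn'.gramInv_mul_sq hx
    have h0 : gramInv G x (base x) 0 0 ≠ 0 := left_ne_zero_of_mul (h.trans_ne one_ne_zero)
    have hsq := mul_left_cancel₀ h0 (h.trans h'.symm)
    exact (pow_left_inj₀ (hn.apply_coordVec_zero_pos hx).le (hn'.apply_coordVec_zero_pos hx).le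
      two_ne_zero).1 hsq
  · rw [hn.apply_coordVec hx a ha, hn'.apply_coordVec hx a ha]

lemma covComp_base (μ : CovectorField d M) (x : M) (a : Fin d) :
    covComp μ x a (base x) = μ x (coordVec x a x) := by
  rw [covComp, pt_base]

/-- Tangential covariant derivatives of two unit conormal fields agree along the boundary. -/
lemma IsUnitConormal.covDeriv_eq (hn : IsUnitConormal G n) (hn' : IsUnitConormal G n')
    {x : M} (hx : x ∈ (𝓡∂ d).boundary M) {a : Fin d} (ha : a ≠ 0) (b : Fin d) :
    covDeriv G n x a b = covDeriv G n' x a b := by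
  -- The fields agree only on the boundary, which determines derivatives in the directions `a ≠ 0`;
  -- the Christoffel terms involve only values at `x`.
  have h : pderiv a (covComp n x b) (base x) = pderiv a (covComp n' x b) (base x) := by
    refine pderiv_eq_of_eq_on_hyperplane (base_zero_of_mem_boundary hx)
      ((contDiffWithinAt_covComp hn.smooth x b).differentiableWithinAt (by simp))
      ((contDiffWithinAt_covComp hn'.smooth x b).differentiableWithinAt (by simp)) ?_ ha
    filter_upwards [eventually_pt_mem_boundary] with y hy
    rw [covComp, covComp, hn.eq_on_boundary hn' hy]
  simp only [covDeriv, h, covComp_base, hn.eq_on_boundary hn' hx]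

end Conormal

/-! ### Mean curvature. -/

section MeanCurvature

variable {d : ℕ} [NeZero d] {M : Type*} [TopologicalSpace M]
  [ChartedSpace (EuclideanHalfSpace d) M] [IsManifold (𝓡∂ d) ∞ M]
  {g : SmoothMetric d M} {n n' : CovectorField d M}

/-- The unit normal vector has components `n^a = G^{a0} n_0` along the boundary. -/
lemma IsUnitConormal.sum_gramInv_mul {G : BilinField d M} (hn : IsUnitConormal G n) {x : M}
    (hx : x ∈ (𝓡∂ d).boundary M) (a : Fin d) :
    ∑ c, gramInv G x (base x) a c * covComp n x c (base x)
      = gramInv G x (base x) a 0 * n x (coordVec x 0 x) := by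
  rw [Finset.sum_eq_single 0]
  · rw [covComp_base]
  · intro c _ hc
    rw [covComp_base, hn.apply_coordVec hx c hc, mul_zero]
  · simp

/-- The mean curvature does not depend on the extension of the unit conormal. -/
lemma IsUnitConormal.meanCurvature_eq (hn : IsUnitConormal (fun x => g.inner x) n)
    (hn' : IsUnitConormal (fun x => g.inner x) n') {x : M} (hx : x ∈ (𝓡∂ d).boundary M) :
    meanCurvature (fun x => g.inner x) n x = meanCurvature (fun x => g.inner x) n' x := by
  simp only [meanCurvature]
  simp only [hn.sum_gramInv_mul hx, hn'.sum_gramInv_mul hx, hn.eq_on_boundary hn' hx]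
  congr 1
  refine Finset.sum_congr rfl fun a _ => Finset.sum_congr rfl fun b _ => ?_
  -- Along the boundary `n` is a multiple of `dy⁰`, and `G^{ab} - n^a n^b` annihilates `n_a`. So the
  -- row `a = 0` vanishes and no transversal derivative survives.
  by_cases ha : a = 0
  · subst ha
    have h : gramInv (fun x => g.inner x) x (base x) 0 b
        - gramInv (fun x => g.inner x) x (base x) 0 0 * n' x (coordVec x 0 x)
          * (gramInv (fun x => g.inner x) x (base x) b 0 * n' x (coordVec x 0 x)) = 0 := by
      rw [gramInv_symm g x _ b 0]
      linear_combination -(gramInv (fun x => g.inner x) x (base x) 0 b) * hn'.gramInv_mul_sq hx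
    rw [h, zero_mul, zero_mul]
  · rw [hn.covDeriv_eq hn' hx ha]

/-- If `∇n = -ρ g` at a boundary point, then `H = -ρ` there. -/
lemma IsUnitConormal.meanCurvature_of_umbilic (hd : 3 ≤ d)
    (hn : IsUnitConormal (fun x => g.inner x) n) {x : M} (hx : x ∈ (𝓡∂ d).boundary M) {ρ : ℝ}
    (h : ∀ a b, covDeriv (fun x => g.inner x) n x a b
      = -ρ * gram (fun x => g.inner x) x (base x) a b) :
    meanCurvature (fun x => g.inner x) n x = -ρ := by
  have hd' : (d : ℝ) - 1 ≠ 0 := by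
    have : (3 : ℝ) ≤ d := by exact_mod_cast hd
    linarith
  have hNN : ∑ a, ∑ b, (gramInv (fun x => g.inner x) x (base x) a 0 * n x (coordVec x 0 x))
      * (gramInv (fun x => g.inner x) x (base x) b 0 * n x (coordVec x 0 x))
      * gram (fun x => g.inner x) x (base x) a b = 1 := by
    have h1 : ∀ a, ∑ b, gram (fun x => g.inner x) x (base x) a b
        * gramInv (fun x => g.inner x) x (base x) b 0 = if a = 0 then 1 else 0 := by
      intro a
      rw [← Matrix.mul_apply, gramInv,
        Matrix.mul_nonsing_inv _ (isUnit_det_gram_metric g (pt_base_mem_source x)),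
        Matrix.one_apply]
    calc _ = ∑ a, gramInv (fun x => g.inner x) x (base x) a 0 * n x (coordVec x 0 x) ^ 2
          * ∑ b, gram (fun x => g.inner x) x (base x) a b
            * gramInv (fun x => g.inner x) x (base x) b 0 := by
          simp only [Finset.mul_sum]
          exact Finset.sum_congr rfl fun a _ => Finset.sum_congr rfl fun b _ => by ring
      _ = 1 := by simp [h1, hn.gramInv_mul_sq hx]
  simp only [meanCurvature, hn.sum_gramInv_mul hx, h]
  rw [div_eq_iff hd']
  -- The trace of `g` against `g⁻¹ - n ⊗ n` is `d - 1`.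
  calc _ = -ρ * (∑ a, ∑ b, gramInv (fun x => g.inner x) x (base x) a b
          * gram (fun x => g.inner x) x (base x) a b
        - ∑ a, ∑ b, (gramInv (fun x => g.inner x) x (base x) a 0 * n x (coordVec x 0 x))
          * (gramInv (fun x => g.inner x) x (base x) b 0 * n x (coordVec x 0 x))
          * gram (fun x => g.inner x) x (base x) a b) := by
        simp only [← Finset.sum_sub_distrib, Finset.mul_sum]
        exact Finset.sum_congr rfl fun a _ => Finset.sum_congr rfl fun b _ => by ring
    _ = -ρ * ((d : ℝ) - 1) := by rw [hNN, sum_gramInv_mul_gram]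

end MeanCurvature

/-! ### Boundary values of a Poincaré–Einstein tractor. -/

section PoincareEinstein

variable {d : ℕ} [NeZero d] {M : Type*} [TopologicalSpace M]
  [ChartedSpace (EuclideanHalfSpace d) M] [IsManifold (𝓡∂ d) ∞ M]
  {c : ConformalStructure d M} {I : Tractor c}

/-- On a Poincaré–Einstein manifold `|μ| = 1` along the boundary. -/
lemma IsPoincareEinstein.covInner_eq_one (hd : 3 ≤ d) (hI : IsPoincareEinstein c I)
    (g : c.Metric) {x : M} (hx : x ∈ (𝓡∂ d).boundary M) :
    covInner g.form x (I.μ g x) (I.μ g x) = 1 := by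
  -- The squared length of `I` written in the fixed chart at `x`: `covInner` uses a chart that
  -- varies with the point, which would hide continuity.
  let F : EuclideanSpace ℝ (Fin d) → ℝ := fun y =>
    ∑ a, ∑ b, gramInv g.form x y a b * covComp (I.μ g) x a y * covComp (I.μ g) x b y
      + 2 * I.σ g (pt x y) * I.ρ g (pt x y)
  have hFcont : ContinuousWithinAt F (range (𝓡∂ d)) (base x) := by
    have hμ := fun a => (contDiffWithinAt_covComp (I.smooth_μ g) x a).continuousWithinAt
    refine ContinuousWithinAt.add ?_ ?_
    · exact tendsto_finsetSum _ fun a _ => tendsto_finsetSum _ fun b _ =>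
        ((continuousWithinAt_gramInv g.1 x a b).mul (hμ a)).mul (hμ b)
    · exact (continuousWithinAt_const.mul
        (contDiffWithinAt_comp_pt (I.smooth_σ g x)).continuousWithinAt).mul
        (contDiffWithinAt_comp_pt (I.smooth_ρ g x)).continuousWithinAt
  have hF : F (base x) = 1 := by
    refine eq_of_tendsto_of_eq_on_interior hFcont ?_
    filter_upwards [eventually_mem_source x] with y hy hint
    rw [← hI.length_eq_one hd g hint]
    exact congrArg (· + _) (covInner_eq_in_chart g.1 hy _ _).symm
  simp only [F, covComp_base, pt_base, hI.zero_boundary g x hx] at hF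
  rw [covInner]
  simpa using hF

/-- On a Poincaré–Einstein manifold `μ = dσ` is a smooth extension of the unit conormal. -/
lemma IsPoincareEinstein.isUnitConormal (hd : 3 ≤ d) (hI : IsPoincareEinstein c I)
    (g : c.Metric) : IsUnitConormal g.form (I.μ g) := by
  have hmd : ∀ x, MDifferentiableAt (𝓡∂ d) 𝓘(ℝ, ℝ) (I.σ g) x := fun x =>
    (I.smooth_σ g x).mdifferentiableAt (by simp)
  have happ : ∀ (x : M) (v : EuclideanSpace ℝ (Fin d)), I.μ g x (v : TangentSpace (𝓡∂ d) x)
      = fderivWithin ℝ (fun y => I.σ g (pt x y)) (range (𝓡∂ d)) (base x) v := by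
    intro x v
    rw [hI.parallel.μ_eq g]
    exact differential_apply (hmd x) v
  have hmin : ∀ x ∈ (𝓡∂ d).boundary M,
      IsLocalMinOn (fun y => I.σ g (pt x y)) (range (𝓡∂ d)) (base x) := by
    intro x hx
    -- `pt x y` is a point of `M` for every `y`, and `σ ≥ 0` on all of `M`.
    refine Eventually.of_forall fun y => ?_
    simp only [pt_base, hI.zero_boundary g x hx]
    rcases (𝓡∂ d).isInteriorPoint_or_isBoundaryPoint (pt x y) with h | h
    · exact (hI.pos_interior g _ h).le
    · exact (hI.zero_boundary g _ h).ge
  have htan : ∀ x ∈ (𝓡∂ d).boundary M, ∀ v : EuclideanSpace ℝ (Fin d), v 0 = 0 →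
      I.μ g x (v : TangentSpace (𝓡∂ d) x) = 0 := by
    intro x hx v hv
    rw [happ]
    have hb := (base_zero_of_mem_boundary hx).ge
    exact (hmin x hx).fderivWithin_eq_zero (mem_posTangentCone_range hb hv.ge)
      (mem_posTangentCone_range hb (by simp [hv]))
  have hunit := fun x hx => hI.covInner_eq_one hd g (x := x) hx
  refine ⟨I.smooth_μ g, htan, fun x hx v hv => ?_, hunit⟩
  have h0 : 0 ≤ I.μ g x (EuclideanSpace.single 0 1 : EuclideanSpace ℝ (Fin d)) := by
    rw [happ]
    exact (hmin x hx).fderivWithin_nonneg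
      (mem_posTangentCone_range (base_zero_of_mem_boundary hx).ge (by simp))
  -- If the transversal component vanished as well, `|μ|²` would be `0` instead of `1`.
  have hne : I.μ g x (EuclideanSpace.single 0 1 : EuclideanSpace ℝ (Fin d)) ≠ 0 := by
    intro h
    have h1 := hunit x hx
    rw [covInner_self_of_tangent] at h1
    · rw [coordVec_self, h] at h1
      simp at h1
    · intro a ha
      rw [coordVec_self]
      exact htan x hx _ (by simp [ha.symm])
  rw [show I.μ g x v = _ from apply_eq_mul_of_tangent_eq_zero (I.μ g x) (htan x hx) v]
  exact mul_pos hv (h0.lt_of_ne hne.symm)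

/-- Along the boundary `∇μ = -ρ g`. -/
lemma IsPoincareEinstein.covDeriv_μ (hI : IsPoincareEinstein c I) (g : c.Metric) {x : M}
    (hx : x ∈ (𝓡∂ d).boundary M) (a b : Fin d) :
    covDeriv g.form (I.μ g) x a b = -I.ρ g x * gram g.form x (base x) a b := by
  have := (hI.parallel g x).2.1 a b
  rw [hI.zero_boundary g x hx] at this
  linear_combination this

/-- Along the boundary `Δσ = d ρ`. -/
lemma IsPoincareEinstein.laplacian_σ (hI : IsPoincareEinstein c I) (g : c.Metric) {x : M}
    (hx : x ∈ (𝓡∂ d).boundary M) : laplacian g.form (I.σ g) x = d * I.ρ g x := by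
  have htr : ∑ a, ∑ b, gramInv g.form x (base x) a b * gram g.form x (base x) a b = d :=
    sum_gramInv_mul_gram g.1 x
  rw [laplacian, ← hI.parallel.μ_eq g, ← htr, Finset.sum_mul, ← Finset.sum_neg_distrib]
  refine Finset.sum_congr rfl fun a _ => ?_
  rw [Finset.sum_mul, ← Finset.sum_neg_distrib]
  refine Finset.sum_congr rfl fun b _ => ?_
  rw [hI.covDeriv_μ g hx]
  ring

end PoincareEinstein

end ConfGeom

theorem proposition4p4 (d : ℕ) [NeZero d] (hd : 3 ≤ d)
    (M : Type*) [TopologicalSpace M] [T2Space M] [CompactSpace M]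
    [ChartedSpace (EuclideanHalfSpace d) M] [IsManifold (𝓡∂ d) ∞ M]
    (c : ConfGeom.ConformalStructure d M) (I : ConfGeom.Tractor c)
    (hI : ConfGeom.IsPoincareEinstein c I) (g : c.Metric) :
    (∃ n : ConfGeom.CovectorField d M, ConfGeom.IsUnitConormal g.form n) ∧
    ∀ n : ConfGeom.CovectorField d M, ConfGeom.IsUnitConormal g.form n →
      ∀ x ∈ (𝓡∂ d).boundary M,
        I.inScale g x = ConfGeom.normalTractor g n x ∧
        ConfGeom.meanCurvature g.form n x
          = -(1 / (d : ℝ)) * ConfGeom.laplacian g.form (I.σ g) x := by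
  have hμ := hI.isUnitConormal hd g
  refine ⟨⟨I.μ g, hμ⟩, fun n hn x hx => ?_⟩
  -- Replace `n` by the extension `μ = dσ`, for which `∇μ = -ρ g` on the boundary.
  have hH : ConfGeom.meanCurvature g.form n x = -I.ρ g x :=
    (hn.meanCurvature_eq (g := g.1) hμ hx).trans
      (hμ.meanCurvature_of_umbilic (g := g.1) hd hx (hI.covDeriv_μ g hx))
  constructor
  · rw [ConfGeom.Tractor.inScale, ConfGeom.normalTractor, hH, neg_neg, hI.zero_boundary g x hx,
      hμ.eq_on_boundary hn hx]
  · have hd0 : (d : ℝ) ≠ 0 := Nat.cast_ne_zero.2 (NeZero.ne d)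
    rw [hH, hI.laplacian_σ g hx]
    field_simp
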